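/- Let $f$ be a field of characteristic $0$ and let $m,n\ge 0$ be integers. Let $L_{m+1,n+1}$ be the finite-dimensional nilpotent Lie algebra over $f$ with basis $l_{m+1},\dots,l_n$ and bracket $[l_i,l_j]=(j-i)\,l_{i+j}$ if $i+j\le n$, and $[l_i,l_j]=0$ if $i+j>n$ (that is, $L_{m+1}/L_{n+1}$, where $L_k$ is the Lie algebra with basis $l_i=t^{i+1}\frac{d}{dt}$, $i\ge k$). Identify polynomial functions on the dual space $L_{m+1,n+1}^*$ with elements of the polynomial ring $f[l_{m+1},\dots,l_n]$. A polynomial function is called invariant under the coadjoint representation $T$ if it is annihilated by the induced action of every $l\in L_{m+1,n+1}$ (the derivation of the polynomial ring extending $l_i\mapsto[l,l_i]$). In the statements below, of $l_n,\dots,l_{n-m}$ only those with index at least $m+1$ are meant (this is no restriction if $n\ge 2m+1$). 1. If $n$ is odd, the ring of polynomial invariants of the coadjoint representation of $L_{m+1,n+1}$ is $f[l_n,\dots,l_{n-m}]$. 2. If $n$ is even, there is a polynomial $P\in f[l_{m+1},\dots,l_n]$ such that this ring is $f[l_n,\dots,l_{n-m},P]$; moreover, if $n\ge 2m+2$, then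 $l_n,\dots,l_{n-m},P$ are algebraically independent over $f$. In both cases the same description (with the same $P$) holds for the ring of polynomial functions $F$ on $L_{m+1,n+1}^*$ that are constant on coadjoint orbits, i.e. $F(\exp(T(l))x)=F(x)$ for all $l\in L_{m+1,n+1}$ and $x\in L_{m+1,n+1}^*$. -/

import Mathlib

noncomputable section

/-! ### The Lie algebras `L_{m,n} = L_m / L_n` -/

/-- The index set `{i | m ≤ i < n}` of the basis of `L_{m,n}`. -/
abbrev WittIdx (m n : ℕ) : Type := {i : ℕ // i ∈ Finset.Ico m n}

/-- The underlying space of the Lie algebra `L_{m,n} = L_m / L_n`, where `L_k` has the basis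
`l_i = t^{i+1} d/dt`, `i ≥ k`, with `[l_i, l_j] = (j - i) l_{i+j}`: an element `x` stands for the
class of `∑ x_i l_i`, the sum over `m ≤ i < n`. -/
def WittQuot (f : Type*) (m n : ℕ) : Type _ := WittIdx m n → f

namespace WittQuot

@[ext] protected theorem ext {f : Type*} {m n : ℕ} {x y : WittQuot f m n}
    (h : ∀ i, x i = y i) : x = y := funext h

variable {f : Type*} [Field f] {m n : ℕ}

instance : AddCommGroup (WittQuot f m n) := inferInstanceAs (AddCommGroup (WittIdx m n → f))

instance : Module f (WittQuot f m n) := inferInstanceAs (Module f (WittIdx m n → f))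

theorem add_apply (x y : WittQuot f m n) (i : WittIdx m n) : (x + y) i = x i + y i := rfl

theorem zero_apply (i : WittIdx m n) : (0 : WittQuot f m n) i = 0 := rfl

theorem smul_apply (c : f) (x : WittQuot f m n) (i : WittIdx m n) : (c • x) i = c * x i := rfl

/-- The bilinear extension of `[l_i, l_j] = (j - i) l_{i+j}`, where `l_k = 0` for `k ≥ n`. -/
instance : Bracket (WittQuot f m n) (WittQuot f m n) where
  bracket x y := fun k => ∑ i : WittIdx m n, ∑ j : WittIdx m n,
    if (i : ℕ) + (j : ℕ) = (k : ℕ) then (((j : ℕ) : f) - ((i : ℕ) : f)) * (x i * y j) else 0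

theorem lie_apply (x y : WittQuot f m n) (k : WittIdx m n) :
    ⁅x, y⁆ k = ∑ i : WittIdx m n, ∑ j : WittIdx m n,
      if (i : ℕ) + (j : ℕ) = (k : ℕ) then (((j : ℕ) : f) - ((i : ℕ) : f)) * (x i * y j)
      else 0 := rfl

theorem lie_lie_apply (x y z : WittQuot f m n) (k : WittIdx m n) :
    ⁅x, ⁅y, z⁆⁆ k = ∑ i : WittIdx m n, ∑ a : WittIdx m n, ∑ b : WittIdx m n,
      if (i : ℕ) + ((a : ℕ) + (b : ℕ)) = (k : ℕ) then
        (((a : ℕ) : f) + ((b : ℕ) : f) - ((i : ℕ) : f)) * (((b : ℕ) : f) - ((a : ℕ) : f)) *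
          (x i * y a * z b)
      else 0 := by
  rw [lie_apply]
  refine Finset.sum_congr rfl fun i _ => ?_
  have h1 : ∀ j : WittIdx m n,
      (if (i : ℕ) + (j : ℕ) = (k : ℕ) then (((j : ℕ) : f) - ((i : ℕ) : f)) * (x i * ⁅y, z⁆ j)
        else 0) = ∑ a : WittIdx m n, ∑ b : WittIdx m n,
        if (a : ℕ) + (b : ℕ) = (j : ℕ) then
          (if (i : ℕ) + ((a : ℕ) + (b : ℕ)) = (k : ℕ) then
          (((a : ℕ) : f) + ((b : ℕ) : f) - ((i : ℕ) : f)) * (((b : ℕ) : f) - ((a : ℕ) : f)) *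
          (x i * y a * z b) else 0) else 0 := by
    intro j
    rw [lie_apply]
    split_ifs with h
    · simp only [Finset.mul_sum]
      refine Finset.sum_congr rfl fun a _ => Finset.sum_congr rfl fun b _ => ?_
      by_cases hab : (a : ℕ) + (b : ℕ) = (j : ℕ)
      · rw [if_pos hab, if_pos hab, if_pos (by rw [hab]; exact h), ← hab]
        push_cast
        ring
      · rw [if_neg hab, if_neg hab]
        ring
    · symm
      refine Finset.sum_eq_zero fun a _ => Finset.sum_eq_zero fun b _ => ?_
      by_cases hab : (a : ℕ) + (b : ℕ) = (j : ℕ)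
      · rw [if_pos hab, if_neg (by rw [hab]; exact h)]
      · rw [if_neg hab]
  rw [Finset.sum_congr rfl fun j _ => h1 j, Finset.sum_comm]
  refine Finset.sum_congr rfl fun a _ => ?_
  rw [Finset.sum_comm]
  refine Finset.sum_congr rfl fun b _ => ?_
  by_cases h : (i : ℕ) + ((a : ℕ) + (b : ℕ)) = (k : ℕ)
  · have ha := Finset.mem_Ico.1 a.2
    have hk := Finset.mem_Ico.1 k.2
    rw [Finset.sum_eq_single
      (⟨(a : ℕ) + (b : ℕ), Finset.mem_Ico.2 ⟨by omega, by omega⟩⟩ : WittIdx m n)]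
    · simp
    · intro j _ hj
      rw [if_neg]
      intro e
      exact hj (Subtype.ext e.symm)
    · simp
  · simp [h]

theorem lie_antisymm (x y : WittQuot f m n) : ⁅x, y⁆ = -⁅y, x⁆ := by
  rw [eq_neg_iff_add_eq_zero]
  ext k
  rw [add_apply, lie_apply, lie_apply, zero_apply, Finset.sum_comm, ← Finset.sum_add_distrib]
  refine Finset.sum_eq_zero fun i _ => ?_
  rw [← Finset.sum_add_distrib]
  refine Finset.sum_eq_zero fun j _ => ?_
  rw [Nat.add_comm (j : ℕ) (i : ℕ)]
  split_ifs <;> ring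

instance [CharZero f] : LieRing (WittQuot f m n) where
  add_lie x y z := by
    ext k
    simp only [add_apply, lie_apply, ← Finset.sum_add_distrib]
    refine Finset.sum_congr rfl fun i _ => Finset.sum_congr rfl fun j _ => ?_
    split_ifs <;> ring
  lie_add x y z := by
    ext k
    simp only [add_apply, lie_apply, ← Finset.sum_add_distrib]
    refine Finset.sum_congr rfl fun i _ => Finset.sum_congr rfl fun j _ => ?_
    split_ifs <;> ring
  lie_self x := by
    ext k
    have h := congrFun (lie_antisymm x x) k
    exact self_eq_neg.1 h
  leibniz_lie x y z := by
    rw [lie_antisymm ⁅x, y⁆ z]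
    ext k
    have hneg : (-⁅z, ⁅x, y⁆⁆ : WittQuot f m n) k = -(⁅z, ⁅x, y⁆⁆ k) := rfl
    have e1 : ⁅z, ⁅x, y⁆⁆ k = ∑ a : WittIdx m n, ∑ b : WittIdx m n, ∑ c : WittIdx m n,
        if (c : ℕ) + ((a : ℕ) + (b : ℕ)) = (k : ℕ) then
          (((a : ℕ) : f) + ((b : ℕ) : f) - ((c : ℕ) : f)) * (((b : ℕ) : f) - ((a : ℕ) : f)) *
            (z c * x a * y b)
        else 0 := by
      rw [lie_lie_apply, Finset.sum_comm]
      exact Finset.sum_congr rfl fun a _ => Finset.sum_comm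
    have e2 : ⁅y, ⁅x, z⁆⁆ k = ∑ a : WittIdx m n, ∑ b : WittIdx m n, ∑ c : WittIdx m n,
        if (b : ℕ) + ((a : ℕ) + (c : ℕ)) = (k : ℕ) then
          (((a : ℕ) : f) + ((c : ℕ) : f) - ((b : ℕ) : f)) * (((c : ℕ) : f) - ((a : ℕ) : f)) *
            (y b * x a * z c)
        else 0 := by
      rw [lie_lie_apply, Finset.sum_comm]
    rw [add_apply, hneg, e1, e2, lie_lie_apply, ← Finset.sum_neg_distrib,
      ← Finset.sum_add_distrib]
    refine Finset.sum_congr rfl fun a _ => ?_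
    rw [← Finset.sum_neg_distrib, ← Finset.sum_add_distrib]
    refine Finset.sum_congr rfl fun b _ => ?_
    rw [← Finset.sum_neg_distrib, ← Finset.sum_add_distrib]
    refine Finset.sum_congr rfl fun c _ => ?_
    rw [show (c : ℕ) + ((a : ℕ) + (b : ℕ)) = (a : ℕ) + ((b : ℕ) + (c : ℕ)) by ring,
      show (b : ℕ) + ((a : ℕ) + (c : ℕ)) = (a : ℕ) + ((b : ℕ) + (c : ℕ)) by ring]
    split_ifs <;> ring

instance [CharZero f] : LieAlgebra f (WittQuot f m n) where
  lie_smul t x y := by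
    ext k
    simp only [smul_apply, lie_apply, Finset.mul_sum]
    refine Finset.sum_congr rfl fun i _ => Finset.sum_congr rfl fun j _ => ?_
    split_ifs <;> ring

variable (f m n) in
/-- The basis `(l_i)`, `m ≤ i < n`, of `L_{m,n}`. -/
def basis : Module.Basis (WittIdx m n) f (WittQuot f m n) :=
  Module.Basis.ofEquivFun (LinearEquiv.refl f (WittIdx m n → f))

end WittQuot

/-! ### Polynomial invariants of the coadjoint representation -/

section Invariants

variable {f L ι : Type*} [Field f] [LieRing L] [LieAlgebra f L]

/-- The derivation of the algebra `f[l_i | i ∈ ι]` of polynomial functions on `L^*` (the symmetric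
algebra of `L`), for a basis `(l_i)` of `L`, by which `l` acts on it: it extends `l_i ↦ [l, l_i]`.
On functions it is `(l F)(x) = -dF_x (l x)`, with `l x` the coadjoint action. -/
def coadjointDerivation [Fintype ι] (b : Module.Basis ι f L) (l : L) :
    Derivation f (MvPolynomial ι f) (MvPolynomial ι f) :=
  MvPolynomial.mkDerivation f fun i => ∑ j, b.repr ⁅l, b i⁆ j • MvPolynomial.X j

/-- The ring of polynomial functions on `L^*` that are invariant under the coadjoint representation
of the Lie algebra `L`, i.e. annihilated by every `l ∈ L`. -/
def coadjointInvariants [Fintype ι] (b : Module.Basis ι f L) :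
    Subalgebra f (MvPolynomial ι f) where
  carrier := {F | ∀ l : L, coadjointDerivation b l F = 0}
  mul_mem' {F G} hF hG l := by rw [Derivation.leibniz, hF l, hG l]; simp
  add_mem' {F G} hF hG l := by rw [map_add, hF l, hG l, add_zero]
  algebraMap_mem' c l := (coadjointDerivation b l).map_algebraMap c

/-- The value at `x ∈ L^*` of a polynomial in the basis `(l_i)` of `L`, where `l_i` is the function
`x ↦ x(l_i)` on `L^*`. -/
def evalDual (b : Module.Basis ι f L) (x : Module.Dual f L) : MvPolynomial ι f →ₐ[f] f :=
  MvPolynomial.aeval fun i => x (b i)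

/-- The automorphism `exp T(l) = ∑ T(l)^k / k!` of `L^*`, with `T` the coadjoint representation of
a (finite-dimensional nilpotent) Lie algebra `L`. -/
def coadjointExp [CharZero f] (l : L) : Module.End f (Module.Dual f L) :=
  IsNilpotent.exp (LieModule.toEnd f L (Module.Dual f L) l)

/-- The ring of polynomial functions on `L^*` that are invariant under all the automorphisms
`exp T(l)`, `l ∈ L`, i.e. constant on the coadjoint orbits. -/
def coadjointOrbitInvariants [CharZero f] (b : Module.Basis ι f L) :
    Subalgebra f (MvPolynomial ι f) where
  carrier := {F | ∀ (l : L) (x : Module.Dual f L),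
    evalDual b (coadjointExp (f := f) l x) F = evalDual b x F}
  mul_mem' {F G} hF hG l x := by rw [map_mul, map_mul, hF l x, hG l x]
  add_mem' {F G} hF hG l x := by rw [map_add, map_add, hF l x, hG l x]
  algebraMap_mem' c l x := by rw [AlgHom.commutes, AlgHom.commutes]

end Invariants

end

/-! Write `D_a` for the action of `l_a`, so that `D_a F = ∑ (i - a) l_{a+i} ∂_i F`, and `C` for the
polynomial ring in the central variables `l_i`, `i ≥ n - m`, all of which are invariant. For a
non-central index `j` take `a = n - j`: terms with `i > j` vanish because `a + i > n`, so, by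
induction on `j`, `D_a F = 0` reduces to `(2j - n) l_n ∂_j F = 0`. For odd `n` this kills every
non-central partial derivative and the invariants are `C`. For `n = 2k` it gives `∂_j F = 0` for `j
< k`, and an invariant with `∂_k F = 0` lies in `C`.

An extra invariant for `n = 2k`, `k ≥ m + 1`, comes from a square root. With `u = l_{2k}` put `W = 1
+ ∑ l_{2k-i} u^{i-1} t^i`. Modulo `t^{k+1}`, `D_a W = u^a t^a (2k - 2a - t d/dt) W`, hence for `S =
√W` one gets `D_a S = u^a t^a (k - a - t d/dt) S`, whose coefficient at `t^k` is zero. So the `k`-th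
coefficient of `S` is invariant. Removing its part in `C` and dividing by `u^m` gives `P`
(`exists_mem_coadjointInvariants`).

That `C` and `P` generate everything takes two steps. Integrating in `l_k` shows that `u^N F ∈ C[P]`
for every invariant `F` (`exists_pow_mul_eq_aeval`). The powers of `u` then cancel because `P` stays
transcendental over `C` modulo `u` (`exists_eq_aeval_of_pow_mul_eq`); this is why the division by
`u^m` is needed.

Orbit invariance agrees with infinitesimal invariance because `exp (t T(l)) x` is polynomial in `t`,
and `F` along it has derivative `-(l F)`. -/

noncomputable section

/-! ### Derivations and partial derivatives in characteristic zero -/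

section General

open MvPolynomial

/-- Reduces membership in the ring of central variables to the vanishing of partial derivatives;
characteristic zero keeps the exponent factors from vanishing. -/
theorem MvPolynomial.mem_supported_iff_pderiv_eq_zero {f σ : Type*} [Field f] [CharZero f]
    (s : Set σ) (F : MvPolynomial σ f) :
    F ∈ supported f s ↔ ∀ j, j ∉ s → pderiv j F = 0 := by
  constructor
  · intro hF j hj
    exact pderiv_eq_zero_of_notMem_vars fun h => hj (mem_supported.1 hF h)
  · intro h
    rw [mem_supported]
    intro j hj
    by_contra hjs
    obtain ⟨d, hd, hjd⟩ := (mem_vars_iff_mem_support j).1 hj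
    have h1 := congrArg (coeff (d - Finsupp.single j 1)) (h j hjs)
    have h2 : d - Finsupp.single j 1 + Finsupp.single j 1 = d :=
      tsub_add_cancel_of_le (by
        rw [Finsupp.single_le_iff]
        exact Nat.one_le_iff_ne_zero.2 (Finsupp.mem_support_iff.1 hjd))
    rw [coeff_pderiv, h2, coeff_zero] at h1
    rcases mul_eq_zero.1 h1 with h3 | h3
    · exact (mem_support_iff.1 hd) h3
    · exact Nat.cast_add_one_ne_zero _ h3

theorem MvPolynomial.pderiv_comm {f σ : Type*} [CommRing f] (i j : σ) (F : MvPolynomial σ f) :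
    pderiv i (pderiv j F) = pderiv j (pderiv i F) := by
  classical
  have h : ⁅(pderiv i : Derivation f (MvPolynomial σ f) (MvPolynomial σ f)),
      (pderiv j : Derivation f (MvPolynomial σ f) (MvPolynomial σ f))⁆ = 0 := by
    refine MvPolynomial.derivation_ext fun k => ?_
    rw [Derivation.commutator_apply, pderiv_X, pderiv_X]
    simp only [Pi.single_apply, apply_ite, map_zero, Derivation.map_one_eq_zero]
    simp
  have h2 := DFunLike.congr_fun h F
  rw [Derivation.commutator_apply, Derivation.zero_apply, sub_eq_zero] at h2
  exact h2

theorem Derivation.map_aeval_subalgebra {f R : Type*} [CommRing f] [CommRing R]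
    [Algebra f R] (C : Subalgebra f R) (D : Derivation f R R) (hC : ∀ c ∈ C, D c = 0) {P : R}
    (q : Polynomial C) :
    D (Polynomial.aeval P q) = Polynomial.aeval P (Polynomial.derivative q) * D P := by
  induction q using Polynomial.induction_on' with
  | add p q hp hq => simp only [map_add, hp, hq, add_mul]
  | monomial k a =>
    rw [Polynomial.derivative_monomial, Polynomial.aeval_monomial, Polynomial.aeval_monomial,
      Derivation.leibniz, Derivation.leibniz_pow]
    have h1 : D (algebraMap C R a) = 0 := hC _ a.2
    have h2 : algebraMap C R (k : C) = (k : R) := _root_.map_natCast (algebraMap C R) k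
    rw [h1, map_mul, h2, nsmul_eq_mul, smul_eq_mul, smul_zero, add_zero, smul_eq_mul]
    ring

/-- If a derivation `D` preserves a prime ideal `I`, kills `C` and does not send `P` into `I`, then
`P` is transcendental modulo `I` over `C`. -/
theorem Derivation.coeff_mem_of_aeval_mem {f R : Type*} [Field f] [CharZero f] [CommRing R]
    [Algebra f R] (C : Subalgebra f R) (D : Derivation f R R) (hC : ∀ c ∈ C, D c = 0)
    (I : Ideal R) [I.IsPrime] (hI : ∀ x ∈ I, D x ∈ I) {P : R} (hP : D P ∉ I)
    (p : Polynomial C) (hp : Polynomial.aeval P p ∈ I) (i : ℕ) : (p.coeff i : R) ∈ I := by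
  have key : ∀ d : ℕ, ∀ q : Polynomial C, q.natDegree ≤ d → Polynomial.aeval P q ∈ I →
      ∀ i, (q.coeff i : R) ∈ I := by
    intro d
    induction d with
    | zero =>
      intro q hq h i
      rw [Polynomial.eq_C_of_natDegree_le_zero hq, Polynomial.aeval_C] at h
      by_cases hi : i = 0
      · subst hi; exact h
      · rw [Polynomial.coeff_eq_zero_of_natDegree_lt (by omega)]; simp
    | succ d ih =>
      intro q hq h
      -- `D (q(P)) = q'(P) D P` lies in the prime `I` while `D P` does not, so the induction
      -- hypothesis applies to `q'`.
      have h1 : Polynomial.aeval P (Polynomial.derivative q) ∈ I := by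
        have := hI _ h
        rw [D.map_aeval_subalgebra C hC] at this
        exact (Ideal.IsPrime.mem_or_mem ‹_› this).resolve_right hP
      have h2 := ih _ ((Polynomial.natDegree_derivative_le q).trans (by omega)) h1
      have h3 : ∀ i, (q.coeff (i + 1) : R) ∈ I := by
        intro i
        have h4 := h2 i
        rw [Polynomial.coeff_derivative] at h4
        have h5 : (q.coeff (i + 1) : R) = algebraMap f R ((i + 1 : f)⁻¹) *
            ((q.coeff (i + 1) * ((i : C) + 1) : C) : R) := by
          have : ((i : R) + 1) = algebraMap f R (i + 1) := by simp
          push_cast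
          rw [this, mul_comm, mul_assoc, ← map_mul,
            mul_inv_cancel₀ (Nat.cast_add_one_ne_zero i), map_one, mul_one]
        rw [h5]
        exact I.mul_mem_left _ h4
      intro i
      cases i with
      | succ i => exact h3 i
      | zero =>
        -- The derivative does not see the constant coefficient; it is what remains of `q(P)` after
        -- subtracting terms already known to be in `I`.
        rw [← Polynomial.divX_mul_X_add q, map_add, map_mul, Polynomial.aeval_C,
          Polynomial.aeval_X] at h
        have h6 : Polynomial.aeval P q.divX ∈ I := by
          rw [Polynomial.aeval_eq_sum_range]
          refine I.sum_mem fun i _ => ?_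
          rw [Polynomial.coeff_divX, Algebra.smul_def]
          exact I.mul_mem_right _ (h3 i)
        exact (I.add_mem_iff_right (I.mul_mem_right _ h6)).1 h
  exact key _ p le_rfl hp i

theorem Polynomial.exists_derivative_eq {f A : Type*} [Field f] [CharZero f] [CommRing A]
    [Algebra f A] (p : Polynomial A) : ∃ q : Polynomial A, Polynomial.derivative q = p := by
  induction p using Polynomial.induction_on' with
  | add p q hp hq =>
    obtain ⟨a, rfl⟩ := hp
    obtain ⟨b, rfl⟩ := hq
    exact ⟨a + b, map_add _ _ _⟩
  | monomial k a =>
    refine ⟨Polynomial.monomial (k + 1) ((k + 1 : f)⁻¹ • a), ?_⟩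
    rw [Polynomial.derivative_monomial]
    congr 1
    rw [smul_mul_assoc, show a * ((k + 1 : ℕ) : A) = ((k : f) + 1) • a by
      rw [Algebra.smul_def]; push_cast; simp [mul_comm], smul_smul,
      inv_mul_cancel₀ (Nat.cast_add_one_ne_zero k), one_smul]

end General

/-! ### Square roots of power series -/

namespace PowerSeries

/-- Substitute `W - 1` into the binomial series of `(1 + X)^{1/2}`. -/
theorem exists_sq_eq {A : Type*} [CommRing A] [Algebra ℚ A] (W : PowerSeries A)
    (hW : constantCoeff W = 1) : ∃ S : PowerSeries A, constantCoeff S = 1 ∧ S * S = W := by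
  have hs : HasSubst (W - 1) := HasSubst.of_constantCoeff_zero' (by simp [hW])
  have h0 : constantCoeff (binomialSeries ℚ (1 / 2 : ℚ) - 1) = 0 := by simp
  refine ⟨(binomialSeries ℚ (1 / 2 : ℚ)).subst (W - 1), ?_, ?_⟩
  · have h1 := constantCoeff_subst_eq_zero (a := W - 1) (by
      show constantCoeff (W - 1) = 0
      simp [hW]) _ h0
    have h2 : subst (W - 1) (1 : PowerSeries ℚ) = (1 : PowerSeries A) := by
      rw [← coe_substAlgHom hs, map_one]
    rw [subst_sub hs, h2] at h1
    have h3 : constantCoeff (subst (W - 1) (binomialSeries ℚ (1 / 2 : ℚ)) - 1) = 0 := h1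
    rw [map_sub, map_one, sub_eq_zero] at h3
    exact h3
  · rw [← subst_mul hs, ← binomialSeries_add]
    have : binomialSeries ℚ (1 / 2 + 1 / 2 : ℚ) = 1 + X := by
      have := binomialSeries_nat (R := ℚ) (A := ℚ) 1
      rw [Nat.cast_one, pow_one] at this
      rw [← this]
      norm_num
    rw [this, ← coe_substAlgHom hs, map_add, map_one, substAlgHom_X]
    ring

/-- The derivation of the power series ring that acts coefficientwise as `D`. -/
def mapDer {f A : Type*} [CommRing f] [CommRing A] [Algebra f A] (D : Derivation f A A)
    (F : PowerSeries A) : PowerSeries A := mk fun i => D (coeff i F)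

section
variable {f A : Type*} [CommRing f] [CommRing A] [Algebra f A] (D : Derivation f A A)

theorem coeff_mapDer (F : PowerSeries A) (i : ℕ) : coeff i (mapDer D F) = D (coeff i F) :=
  coeff_mk _ _

theorem mapDer_mul (F G : PowerSeries A) :
    mapDer D (F * G) = F * mapDer D G + G * mapDer D F := by
  rw [mul_comm G]
  ext i
  simp only [map_add, coeff_mapDer, coeff_mul, map_sum, Derivation.leibniz, smul_eq_mul,
    Finset.sum_add_distrib]
  congr 1
  exact Finset.sum_congr rfl fun _ _ => mul_comm _ _

end

/-- Here `V` is `±(1 + X)^{-1/2}`. Differentiating gives `2 (1 + X) V' + V = 0`, that is `2 (i + 1)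
V_{i+1} = -(2i + 1) V_i`, so a zero coefficient would propagate down to `V_0`. -/
theorem coeff_ne_zero_of_sq_mul_eq_one {f : Type*} [Field f] [CharZero f] (V : PowerSeries f)
    (hV : V * V * (1 + X) = 1) (i : ℕ) : coeff i V ≠ 0 := by
  have hV0 : V ≠ 0 := by
    rintro rfl
    simp at hV
  have hd := congrArg (derivative f) hV
  rw [Derivation.leibniz, Derivation.leibniz, map_add, derivative_X, derivative_one] at hd
  simp only [smul_eq_mul] at hd
  have hd2 : V * (derivative f V + derivative f V + X * (derivative f V + derivative f V) + V) =
      0 := by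
    linear_combination hd
  have hd3 := (mul_eq_zero.1 hd2).resolve_left hV0
  induction i with
  | zero =>
    intro h
    have := congrArg constantCoeff hV
    rw [coeff_zero_eq_constantCoeff_apply] at h
    simp [h] at this
  | succ i ih =>
    intro h
    apply ih
    have h2 := congrArg (coeff i) hd3
    cases i with
    | zero =>
      rw [map_add, map_add, map_add, coeff_derivative, coeff_zero_X_mul, h] at h2
      simpa using h2
    | succ i =>
      rw [map_add, map_add, map_add, coeff_derivative, coeff_succ_X_mul, map_add,
        coeff_derivative, h, map_zero] at h2
      have h3 : coeff (i + 1) V * ((2 * i + 2 + 1 : ℕ) : f) = 0 := by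
        push_cast
        linear_combination h2
      exact (mul_eq_zero.1 h3).resolve_right (Nat.cast_ne_zero.2 (by omega))

end PowerSeries

/-! ### Orbit invariants versus infinitesimal invariants -/

section Invariants

variable {f L ι : Type*} [Field f] [LieRing L] [LieAlgebra f L]

theorem coadjointDerivation_X [Fintype ι] (b : Module.Basis ι f L) (l : L) (i : ι) :
    coadjointDerivation b l (MvPolynomial.X i) =
      ∑ j, b.repr ⁅l, b i⁆ j • MvPolynomial.X j :=
  MvPolynomial.mkDerivation_X _ _ _

theorem toEnd_dual_pow_succ_apply (l : L) (k : ℕ) (x : Module.Dual f L) (v : L) :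
    (LieModule.toEnd f L (Module.Dual f L) l ^ (k + 1)) x v =
      -(LieModule.toEnd f L (Module.Dual f L) l ^ k) x ⁅l, v⁆ := by
  rw [pow_succ']
  rfl

/-- The polynomial in `t` whose value at `t` is the pairing of `exp (t T(l)) x` with `v`, if
`T(l) ^ N = 0`. -/
def coadjointCurve (l : L) (N : ℕ) (x : Module.Dual f L) (v : L) : Polynomial f :=
  ∑ k ∈ Finset.range N, Polynomial.monomial k
    ((k.factorial : f)⁻¹ * (LieModule.toEnd f L (Module.Dual f L) l ^ k) x v)

theorem coeff_coadjointCurve {l : L} {N : ℕ}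
    (hN : LieModule.toEnd f L (Module.Dual f L) l ^ N = 0) (x : Module.Dual f L) (v : L) (k : ℕ) :
    (coadjointCurve l N x v).coeff k =
      (k.factorial : f)⁻¹ * (LieModule.toEnd f L (Module.Dual f L) l ^ k) x v := by
  rw [coadjointCurve, Polynomial.finsetSum_coeff]
  simp only [Polynomial.coeff_monomial]
  rw [Finset.sum_ite_eq' (Finset.range N) k]
  split_ifs with h
  · rfl
  · rw [pow_eq_zero_of_le (by simpa using h) hN]
    simp

theorem coadjointCurve_eq_sum [Fintype ι] {l : L} {N : ℕ}
    (hN : LieModule.toEnd f L (Module.Dual f L) l ^ N = 0) (b : Module.Basis ι f L) (x : Module.Dual f L) (v : L) :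
    coadjointCurve l N x v = ∑ j, b.repr v j • coadjointCurve l N x (b j) := by
  ext k
  simp only [coeff_coadjointCurve hN, Polynomial.finsetSum_coeff, Polynomial.coeff_smul]
  conv_lhs => rw [← b.sum_repr v]
  rw [map_sum, Finset.mul_sum]
  refine Finset.sum_congr rfl fun j _ => ?_
  rw [map_smul, smul_eq_mul, smul_eq_mul]
  ring

theorem derivative_coadjointCurve [CharZero f] {l : L} {N : ℕ}
    (hN : LieModule.toEnd f L (Module.Dual f L) l ^ N = 0) (x : Module.Dual f L) (v : L) :
    Polynomial.derivative (coadjointCurve l N x v) = -coadjointCurve l N x ⁅l, v⁆ := by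
  ext k
  rw [Polynomial.coeff_derivative, Polynomial.coeff_neg, coeff_coadjointCurve hN,
    coeff_coadjointCurve hN, toEnd_dual_pow_succ_apply, Nat.factorial_succ]
  have := Nat.cast_add_one_ne_zero (R := f) k
  have h2 : (k.factorial : f) ≠ 0 := Nat.cast_ne_zero.2 k.factorial_ne_zero
  push_cast
  field_simp

/-- The chain rule along the curve `exp (t T(l)) x`; the sign is that of the dual representation. -/
theorem derivative_aeval_coadjointCurve [CharZero f] [Fintype ι] {l : L} {N : ℕ}
    (hN : LieModule.toEnd f L (Module.Dual f L) l ^ N = 0) (b : Module.Basis ι f L)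
    (x : Module.Dual f L) (F : MvPolynomial ι f) :
    Polynomial.derivative (MvPolynomial.aeval (fun i => coadjointCurve l N x (b i)) F) =
      -MvPolynomial.aeval (fun i => coadjointCurve l N x (b i)) (coadjointDerivation b l F) := by
  induction F using MvPolynomial.induction_on with
  | C a =>
    have : coadjointDerivation b l (MvPolynomial.C a) = 0 :=
      (coadjointDerivation b l).map_algebraMap a
    rw [this, MvPolynomial.aeval_C]
    simp
  | add p q hp hq => rw [map_add, map_add, hp, hq, map_add, map_add, neg_add]
  | mul_X p i hp =>
    rw [map_mul, Polynomial.derivative_mul, hp, MvPolynomial.aeval_X,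
      derivative_coadjointCurve hN, Derivation.leibniz, coadjointDerivation_X,
      coadjointCurve_eq_sum hN b x ⁅l, b i⁆]
    simp only [smul_eq_mul, map_add, map_mul, map_sum, map_smul, MvPolynomial.aeval_X]
    ring

theorem eval_aeval_coadjointCurve [CharZero f] {l : L} {N : ℕ}
    (hN : LieModule.toEnd f L (Module.Dual f L) l ^ N = 0) (b : Module.Basis ι f L)
    (x : Module.Dual f L) (F : MvPolynomial ι f) (c : f) :
    (MvPolynomial.aeval (fun i => coadjointCurve l N x (b i)) F).eval c =
      evalDual b (coadjointExp (f := f) (c • l) x) F := by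
  have hcN : LieModule.toEnd f L (Module.Dual f L) (c • l) ^ N = 0 := by
    rw [map_smul, smul_pow, hN, smul_zero]
  have h : (Polynomial.aeval c).comp
      (MvPolynomial.aeval (fun i => coadjointCurve l N x (b i))) =
      evalDual b (coadjointExp (f := f) (c • l) x) := by
    refine MvPolynomial.algHom_ext fun i => ?_
    rw [AlgHom.comp_apply, evalDual, MvPolynomial.aeval_X, MvPolynomial.aeval_X, coadjointExp,
      IsNilpotent.exp_eq_sum hcN, coadjointCurve, map_sum, LinearMap.sum_apply,
      LinearMap.sum_apply]
    refine Finset.sum_congr rfl fun k _ => ?_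
    rw [Polynomial.aeval_monomial, map_smul, smul_pow, LinearMap.smul_apply, LinearMap.smul_apply,
      LinearMap.smul_apply, LinearMap.smul_apply, Rat.smul_def, smul_eq_mul,
      Algebra.algebraMap_self_apply]
    push_cast
    ring
  exact DFunLike.congr_fun h F

/-- By nilpotency `F` along `exp (t T(l)) x` is a polynomial in `t` with derivative `-(l F)` along
the curve. It is constant for all `x` exactly when `l F = 0`; the field is infinite, so polynomials
are determined by their values. -/
theorem coadjointOrbitInvariants_eq_coadjointInvariants [CharZero f] [Fintype ι]
    (b : Module.Basis ι f L)
    (hnil : ∀ l : L, IsNilpotent (LieModule.toEnd f L (Module.Dual f L) l)) :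
    coadjointOrbitInvariants b = coadjointInvariants b := by
  ext F
  constructor
  · intro hF l
    obtain ⟨N, hN⟩ := hnil l
    refine MvPolynomial.funext fun y => ?_
    set x : Module.Dual f L := b.constr f y with hx
    have h1 : MvPolynomial.aeval (fun i => coadjointCurve l N x (b i)) F =
        Polynomial.C (evalDual b x F) := by
      refine Polynomial.funext fun c => ?_
      rw [eval_aeval_coadjointCurve hN, Polynomial.eval_C]
      exact hF _ _
    have h2 := derivative_aeval_coadjointCurve hN b x F
    rw [h1, Polynomial.derivative_C, eq_comm, neg_eq_zero] at h2
    -- At `t = 0` the curve passes through `x`, so `l F` vanishes at the arbitrary point `x`.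
    have h3 := eval_aeval_coadjointCurve hN b x (coadjointDerivation b l F) 0
    rw [h2, Polynomial.eval_zero, zero_smul, coadjointExp, map_zero, IsNilpotent.exp_zero] at h3
    have h4 : evalDual b x = MvPolynomial.aeval y := by
      rw [evalDual]
      congr 1
      funext i
      rw [hx, Module.Basis.constr_basis]
    rw [Module.End.one_apply, h4, MvPolynomial.aeval_eq_eval] at h3
    rw [map_zero]
    exact h3.symm
  · intro hF l x
    obtain ⟨N, hN⟩ := hnil l
    have h2 := derivative_aeval_coadjointCurve hN b x F
    rw [hF l, map_zero, neg_zero] at h2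
    have h3 := Polynomial.eq_C_of_derivative_eq_zero h2
    have h4 := fun c => eval_aeval_coadjointCurve hN b x F c
    have h5 := h4 1
    have h6 := h4 0
    rw [h3, Polynomial.eval_C] at h5 h6
    rw [one_smul] at h5
    have h7 : coadjointExp (f := f) ((0 : f) • l) = 1 := by
      rw [zero_smul, coadjointExp, map_zero, IsNilpotent.exp_zero]
    rw [h7] at h6
    exact h5.symm.trans h6

end Invariants

/-! ### The linear system satisfied by the partial derivatives of an invariant -/

namespace WittQuot

open MvPolynomial

variable {f : Type*} [Field f] {m n : ℕ}

theorem basis_repr_apply (x : WittQuot f m n) (k : WittIdx m n) : (basis f m n).repr x k = x k :=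
  rfl

theorem basis_apply (i k : WittIdx m n) : basis f m n i k = if i = k then 1 else 0 := by
  have h := DFunLike.congr_fun ((basis f m n).repr_self i) k
  rw [Finsupp.single_apply] at h
  exact h

theorem lie_basis_basis_apply (a i k : WittIdx m n) :
    ⁅basis f m n a, basis f m n i⁆ k =
      if (a : ℕ) + (i : ℕ) = (k : ℕ) then ((i : ℕ) : f) - ((a : ℕ) : f) else 0 := by
  rw [lie_apply, Finset.sum_eq_single a, Finset.sum_eq_single i]
  · simp [basis_apply]
  · intro j _ hj
    simp [basis_apply, hj.symm]
  · simp
  · intro j _ hj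
    refine Finset.sum_eq_zero fun c _ => ?_
    simp [basis_apply, hj.symm]
  · simp

variable (f m n) in
/-- The variable `l_j`, as an element of `f[l_m, …, l_{n-1}]`; it is `0` if the index is out of
range. -/
def var (j : ℕ) : MvPolynomial (WittIdx m n) f :=
  if h : j ∈ Finset.Ico m n then X ⟨j, h⟩ else 0

theorem var_coe (j : WittIdx m n) : var f m n j = X j := dif_pos j.2

theorem var_of_le {j : ℕ} (hj : n ≤ j) : var f m n j = 0 :=
  dif_neg fun h => absurd (Finset.mem_Ico.1 h).2 (by omega)

theorem pderiv_var (i : WittIdx m n) (j : ℕ) :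
    pderiv i (var f m n j) = if (i : ℕ) = j then 1 else 0 := by
  by_cases h : j ∈ Finset.Ico m n
  · rw [var, dif_pos h]
    by_cases hij : i = ⟨j, h⟩
    · subst hij; simp
    · rw [pderiv_X_of_ne (Ne.symm hij), if_neg]
      exact fun e => hij (Subtype.ext e)
  · rw [var, dif_neg h, map_zero, if_neg]
    rintro rfl
    exact h i.2

variable [CharZero f]

theorem coadjointDerivation_X_eq (a i : WittIdx m n) :
    coadjointDerivation (basis f m n) (basis f m n a) (X i) =
      (((i : ℕ) : f) - ((a : ℕ) : f)) • var f m n (a + i) := by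
  rw [_root_.coadjointDerivation_X]
  simp only [basis_repr_apply, lie_basis_basis_apply]
  by_cases h : (a : ℕ) + i ∈ Finset.Ico m n
  · rw [var, dif_pos h, Finset.sum_eq_single ⟨(a : ℕ) + i, h⟩, if_pos rfl]
    · intro j _ hj
      rw [if_neg, zero_smul]
      exact fun e => hj (Subtype.ext e.symm)
    · simp
  · rw [var, dif_neg h, smul_zero]
    refine Finset.sum_eq_zero fun j _ => ?_
    rw [if_neg, zero_smul]
    exact fun e => h (e ▸ j.2)

theorem coadjointDerivation_var (a : WittIdx m n) {j : ℕ} (hj : m ≤ j) :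
    coadjointDerivation (basis f m n) (basis f m n a) (var f m n j) =
      ((j : f) - ((a : ℕ) : f)) • var f m n (a + j) := by
  by_cases h : j < n
  · exact var_coe (f := f) ⟨j, Finset.mem_Ico.2 ⟨hj, h⟩⟩ ▸ coadjointDerivation_X_eq a _
  · rw [var_of_le (by omega), var_of_le (by omega), map_zero, smul_zero]

theorem coadjointDerivation_eq_sum (a : WittIdx m n) (F : MvPolynomial (WittIdx m n) f) :
    coadjointDerivation (basis f m n) (basis f m n a) F =
      ∑ i : WittIdx m n, (((i : ℕ) : f) - ((a : ℕ) : f)) • (var f m n (a + i) * pderiv i F) := by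
  have h : coadjointDerivation (basis f m n) (basis f m n a) =
      ∑ i : WittIdx m n, ((((i : ℕ) : f) - ((a : ℕ) : f)) • var f m n (a + i)) •
        (pderiv i : Derivation f (MvPolynomial (WittIdx m n) f) _) := by
    refine MvPolynomial.derivation_ext fun i => ?_
    rw [coadjointDerivation_X_eq, ← Derivation.coeFnAddMonoidHom_apply, map_sum,
      Finset.sum_apply, Finset.sum_eq_single i]
    · simp
    · intro j _ hj
      simp [pderiv_X_of_ne hj.symm]
    · simp
  rw [h, ← Derivation.coeFnAddMonoidHom_apply, map_sum, Finset.sum_apply]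
  refine Finset.sum_congr rfl fun i _ => ?_
  simp

theorem mem_coadjointInvariants_iff (F : MvPolynomial (WittIdx m n) f) :
    F ∈ coadjointInvariants (basis f m n) ↔
      ∀ a, coadjointDerivation (basis f m n) (basis f m n a) F = 0 := by
  refine ⟨fun h a => h _, fun h l => ?_⟩
  have hl : coadjointDerivation (basis f m n) l =
      ∑ a, l a • coadjointDerivation (basis f m n) (basis f m n a) := by
    refine MvPolynomial.derivation_ext fun i => ?_
    rw [_root_.coadjointDerivation_X, ← Derivation.coeFnAddMonoidHom_apply, map_sum,
      Finset.sum_apply]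
    simp only [Derivation.coeFnAddMonoidHom_apply, Derivation.coe_smul, Pi.smul_apply,
      _root_.coadjointDerivation_X, Finset.smul_sum]
    rw [Finset.sum_comm]
    refine Finset.sum_congr rfl fun j _ => ?_
    simp only [smul_smul]
    rw [← Finset.sum_smul]
    congr 1
    conv_lhs => rw [← (basis f m n).sum_repr l]
    rw [sum_lie, map_sum, Finsupp.finsetSum_apply]
    refine Finset.sum_congr rfl fun a _ => ?_
    rw [smul_lie, map_smul]
    rfl
  rw [hl, ← Derivation.coeFnAddMonoidHom_apply, map_sum, Finset.sum_apply]
  refine Finset.sum_eq_zero fun a _ => ?_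
  simp [h a]

/-- All indices are at least `m + 1 ≥ 1`, so bracketing with `l` raises the lowest index. Hence
`T(l)^r x` vanishes on vectors supported in indices `≥ n - r`. -/
theorem isNilpotent_toEnd_dual (l : WittQuot f (m + 1) n) :
    IsNilpotent (LieModule.toEnd f (WittQuot f (m + 1) n)
      (Module.Dual f (WittQuot f (m + 1) n)) l) := by
  refine ⟨n, ?_⟩
  have key : ∀ r : ℕ, ∀ (x : Module.Dual f (WittQuot f (m + 1) n)) (v : WittQuot f (m + 1) n),
      (∀ i : WittIdx (m + 1) n, (i : ℕ) + r < n → v i = 0) →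
      (LieModule.toEnd f (WittQuot f (m + 1) n)
        (Module.Dual f (WittQuot f (m + 1) n)) l ^ r) x v = 0 := by
    intro r
    induction r with
    | zero =>
      intro x v hv
      have : v = 0 := WittQuot.ext fun i => hv i (Finset.mem_Ico.1 i.2).2
      rw [this, map_zero]
    | succ r ih =>
      intro x v hv
      rw [toEnd_dual_pow_succ_apply, ih, neg_zero]
      intro k hk
      rw [lie_apply]
      refine Finset.sum_eq_zero fun i _ => Finset.sum_eq_zero fun j _ => ?_
      split_ifs with h
      · have hi := (Finset.mem_Ico.1 i.2).1
        rw [hv j (by omega)]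
        ring
      · rfl
  ext x v
  exact key n x v fun i hi => by omega

/-- The system is triangular: equation `a = n - j` involves only `v_i` with `i ≤ j`, and its
diagonal entry is `(2j - n) l_n`. This degenerates only at `2j = n`, the case covered by `hc`. -/
theorem eq_zero_of_sum_var_mul_eq_zero {v : WittIdx (m + 1) (n + 1) → MvPolynomial _ f}
    (hv : ∀ a : WittIdx (m + 1) (n + 1), ∑ i : WittIdx (m + 1) (n + 1),
      (((i : ℕ) : f) - ((a : ℕ) : f)) • (var f (m + 1) (n + 1) (a + i) * v i) = 0)
    (j : WittIdx (m + 1) (n + 1)) (hj : (j : ℕ) + m < n)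
    (hc : ∀ i : WittIdx (m + 1) (n + 1), (i : ℕ) ≤ j → 2 * (i : ℕ) = n → v i = 0) : v j = 0 := by
  obtain ⟨j, hjm⟩ := j
  induction j using Nat.strong_induction_on with
  | _ j ih =>
  have hjm' := Finset.mem_Ico.1 hjm
  by_cases h2 : 2 * j = n
  · exact hc _ le_rfl h2
  dsimp only at hj
  -- `n - j ≥ m + 1` is exactly the condition that `j` be non-central.
  have h := hv ⟨n - j, Finset.mem_Ico.2 ⟨by omega, by omega⟩⟩
  rw [Finset.sum_eq_single ⟨j, hjm⟩] at h
  · dsimp only at h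
    rw [Nat.sub_add_cancel (by omega), Nat.cast_sub (by omega), smul_eq_zero, mul_eq_zero] at h
    rcases h with h | h | h
    · exfalso
      apply h2
      have : ((2 * j : ℕ) : f) = (n : f) := by
        push_cast
        linear_combination h
      exact_mod_cast this
    · rw [var, dif_pos (Finset.mem_Ico.2 ⟨by omega, by omega⟩)] at h
      exact absurd h (X_ne_zero _)
    · exact h
  · intro i _ hij
    have hij' : (i : ℕ) ≠ j := fun e => hij (Subtype.ext e)
    rcases lt_or_gt_of_ne hij' with hlt | hlt
    · rw [ih i hlt i.2 (by dsimp only; omega) fun c hci => hc c (hci.trans hlt.le), mul_zero,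
        smul_zero]
    · dsimp only
      rw [var_of_le (by omega), zero_mul, smul_zero]
  · simp

theorem supported_le_coadjointInvariants :
    supported f {i : WittIdx (m + 1) (n + 1) | n ≤ (i : ℕ) + m} ≤
      coadjointInvariants (basis f (m + 1) (n + 1)) := by
  rw [supported, Algebra.adjoin_le_iff]
  rintro _ ⟨i, hi, rfl⟩
  rw [SetLike.mem_coe, mem_coadjointInvariants_iff]
  intro a
  have ha := (Finset.mem_Ico.1 a.2).1
  rw [coadjointDerivation_X_eq, var_of_le, smul_zero]
  simp only [Set.mem_ofPred_eq] at hi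
  omega

theorem coadjointInvariants_of_odd (hn : Odd n) :
    coadjointInvariants (basis f (m + 1) (n + 1)) =
      supported f {i : WittIdx (m + 1) (n + 1) | n ≤ (i : ℕ) + m} := by
  refine le_antisymm (fun F hF => ?_) supported_le_coadjointInvariants
  rw [mem_supported_iff_pderiv_eq_zero]
  intro j hj
  refine eq_zero_of_sum_var_mul_eq_zero (v := fun i => pderiv i F) (fun a => ?_) j
    (by simpa using hj) fun i _ hi => ?_
  · rw [← coadjointDerivation_eq_sum]
    exact hF _
  · rw [Nat.odd_iff] at hn
    omega

theorem pderiv_eq_zero_of_mem_coadjointInvariants {F : MvPolynomial (WittIdx (m + 1) (n + 1)) f}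
    (hF : F ∈ coadjointInvariants (basis f (m + 1) (n + 1))) (j : WittIdx (m + 1) (n + 1))
    (hj : (j : ℕ) + m < n) (hjn : 2 * (j : ℕ) < n) : pderiv j F = 0 := by
  refine eq_zero_of_sum_var_mul_eq_zero (v := fun i => pderiv i F) (fun a => ?_) j hj
    fun i _ hi => ?_
  · rw [← coadjointDerivation_eq_sum]
    exact hF _
  · omega

/-- The commutator of `∂_k` with `D_a` only differentiates the coefficient `l_{a+i}` with `a + i =
k`. Then `i < k`, and `∂_i F` is already zero. -/
theorem pderiv_mem_coadjointInvariants {F : MvPolynomial (WittIdx (m + 1) (n + 1)) f}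
    (hF : F ∈ coadjointInvariants (basis f (m + 1) (n + 1))) (k : WittIdx (m + 1) (n + 1))
    (hk : (k : ℕ) + m < n) (hkn : 2 * (k : ℕ) ≤ n) :
    pderiv k F ∈ coadjointInvariants (basis f (m + 1) (n + 1)) := by
  rw [mem_coadjointInvariants_iff] at *
  intro a
  have ha := (Finset.mem_Ico.1 a.2).1
  have h := congrArg (pderiv k) (hF a)
  rw [coadjointDerivation_eq_sum, map_sum, map_zero] at h
  rw [coadjointDerivation_eq_sum, ← h]
  refine Finset.sum_congr rfl fun i _ => ?_
  rw [Derivation.map_smul, pderiv_mul, pderiv_var, pderiv_comm k i F]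
  split_ifs with hi
  · rw [pderiv_eq_zero_of_mem_coadjointInvariants
      ((mem_coadjointInvariants_iff F).2 hF) i (by omega) (by omega)]
    simp
  · simp

end WittQuot

/-! ### The extra invariant for `n = 2k` -/

namespace WittQuot

open MvPolynomial

variable {f : Type*} [Field f] {m k : ℕ}

variable (f m k) in
/-- The series `∑ l_{2k-i} l_{2k}^{i-1} t^i`, with constant coefficient `1`. -/
def potential : PowerSeries (MvPolynomial (WittIdx (m + 1) (2 * k + 1)) f) :=
  PowerSeries.mk fun i => if i = 0 then 1 else
    var f (m + 1) (2 * k + 1) (2 * k - i) * var f (m + 1) (2 * k + 1) (2 * k) ^ (i - 1)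

theorem coeff_potential (i : ℕ) : PowerSeries.coeff i (potential f m k) = if i = 0 then 1 else
    var f (m + 1) (2 * k + 1) (2 * k - i) * var f (m + 1) (2 * k + 1) (2 * k) ^ (i - 1) :=
  PowerSeries.coeff_mk _ _

theorem constantCoeff_potential : PowerSeries.constantCoeff (potential f m k) = 1 := by
  rw [← PowerSeries.coeff_zero_eq_constantCoeff_apply, coeff_potential, if_pos rfl]

/-- The coefficientwise form of `D_a W = u^a t^a (2k - 2a - t d/dt) W` with `u = l_{2k}`. It is
restricted to `i ≤ k` so that the indices `2k - i ≥ k ≥ m + 1` stay in range. The constant term `1`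
plays the role of `l_{2k} u^{-1}`. -/
theorem coadjointDerivation_coeff_potential [CharZero f] (hk : m + 1 ≤ k) (a : WittIdx (m + 1) (2 * k + 1))
    {i : ℕ} (hi : i ≤ k) :
    coadjointDerivation (basis f (m + 1) (2 * k + 1)) (basis f (m + 1) (2 * k + 1) a)
      (PowerSeries.coeff i (potential f m k)) =
    var f (m + 1) (2 * k + 1) (2 * k) ^ (a : ℕ) * if (a : ℕ) ≤ i then
      (2 * (k : MvPolynomial _ f) - 2 * ((a : ℕ) : MvPolynomial _ f) -
        ((i - a : ℕ) : MvPolynomial _ f)) * PowerSeries.coeff (i - a) (potential f m k) else 0 := by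
  have ha := (Finset.mem_Ico.1 a.2).1
  have h0 : coadjointDerivation (basis f (m + 1) (2 * k + 1)) (basis f (m + 1) (2 * k + 1) a)
      (var f (m + 1) (2 * k + 1) (2 * k)) = 0 := by
    rw [coadjointDerivation_var _ (by omega), var_of_le (by omega), smul_zero]
  rw [coeff_potential, coeff_potential]
  by_cases hi0 : i = 0
  · rw [if_pos hi0, Derivation.map_one_eq_zero, if_neg (by omega), mul_zero]
  · rw [if_neg hi0, Derivation.leibniz, Derivation.leibniz_pow, h0,
      coadjointDerivation_var _ (by omega)]
    simp only [smul_zero, zero_add]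
    by_cases hai : (a : ℕ) ≤ i
    · have hc : ∀ z : MvPolynomial (WittIdx (m + 1) (2 * k + 1)) f,
          (((2 * k - i : ℕ) : f) - ((a : ℕ) : f)) • z =
          (2 * (k : MvPolynomial (WittIdx (m + 1) (2 * k + 1)) f) -
            2 * ((a : ℕ) : MvPolynomial _ f) - ((i - a : ℕ) : MvPolynomial _ f)) * z := by
        intro z
        rw [Algebra.smul_def, map_sub, map_natCast, map_natCast, Nat.cast_sub hai,
          Nat.cast_sub (by omega)]
        push_cast
        ring
      rw [if_pos hai, hc, smul_eq_mul]
      by_cases h2 : i - a = 0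
      · rw [if_pos h2, show (a : ℕ) + (2 * k - i) = 2 * k by omega,
          show (a : ℕ) = i - 1 + 1 by omega, pow_succ]
        ring
      · rw [if_neg h2, show (a : ℕ) + (2 * k - i) = 2 * k - (i - a) by omega,
          show i - 1 = a + (i - a - 1) by omega, pow_add]
        ring
    · rw [if_neg hai, var_of_le (j := a + (2 * k - i)) (by omega), smul_zero, smul_zero, mul_zero]

/-- Taking the square root halves the weight `2k - 2a` to `k - a`, and `k - a - t d/dt` annihilates
`t^{k-a}`, the term that `t^a` moves to `t^k`. -/
theorem coadjointDerivation_coeff_eq_zero_of_sq_eq [CharZero f] (hk : m + 1 ≤ k)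
    {S : PowerSeries (MvPolynomial (WittIdx (m + 1) (2 * k + 1)) f)}
    (hS0 : PowerSeries.constantCoeff S = 1) (hS : S * S = potential f m k)
    (a : WittIdx (m + 1) (2 * k + 1)) :
    coadjointDerivation (basis f (m + 1) (2 * k + 1)) (basis f (m + 1) (2 * k + 1) a)
      (PowerSeries.coeff k S) = 0 := by
  set D := coadjointDerivation (basis f (m + 1) (2 * k + 1)) (basis f (m + 1) (2 * k + 1) a)
  set W := potential f m k
  set c := var f (m + 1) (2 * k + 1) (2 * k) ^ (a : ℕ)
  set dS := PowerSeries.derivative (MvPolynomial (WittIdx (m + 1) (2 * k + 1)) f) S with hdS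
  have hdW : PowerSeries.derivative (MvPolynomial (WittIdx (m + 1) (2 * k + 1)) f) W =
      S * dS + S * dS := by
    rw [← hS, Derivation.leibniz, smul_eq_mul]
  have hX : ∀ (G : PowerSeries (MvPolynomial (WittIdx (m + 1) (2 * k + 1)) f)) (i : ℕ),
      PowerSeries.coeff i (PowerSeries.X * PowerSeries.derivative _ G) =
        (i : MvPolynomial (WittIdx (m + 1) (2 * k + 1)) f) * PowerSeries.coeff i G := by
    intro G i
    cases i with
    | zero => simp
    | succ i => rw [PowerSeries.coeff_succ_X_mul, PowerSeries.coeff_derivative]; push_cast; ring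
  have hnat : ∀ (b i : ℕ) (G : PowerSeries (MvPolynomial (WittIdx (m + 1) (2 * k + 1)) f)),
      PowerSeries.coeff i ((b : PowerSeries (MvPolynomial (WittIdx (m + 1) (2 * k + 1)) f)) * G) =
        (b : MvPolynomial (WittIdx (m + 1) (2 * k + 1)) f) * PowerSeries.coeff i G := by
    intro b i G
    rw [← nsmul_eq_mul, map_nsmul, nsmul_eq_mul]
  set E := PowerSeries.C c * (PowerSeries.X ^ (a : ℕ) *
    ((k : PowerSeries _) * S - ((a : ℕ) : PowerSeries _) * S - PowerSeries.X * dS)) with hE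
  -- This is the equation for `W = S²` modulo `t^{k+1}`; cancelling the unit `S` leaves `2 D S ≡ 2
  -- E`.
  have hdvd : PowerSeries.X ^ (k + 1) ∣ S * (PowerSeries.mapDer D S + PowerSeries.mapDer D S -
      (E + E)) := by
    have h1 : S * (PowerSeries.mapDer D S + PowerSeries.mapDer D S - (E + E)) =
        PowerSeries.mapDer D W - PowerSeries.C c * (PowerSeries.X ^ (a : ℕ) *
          (((2 * k : ℕ) : PowerSeries _) * W - ((2 * a : ℕ) : PowerSeries _) * W -
            PowerSeries.X * PowerSeries.derivative _ W)) := by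
      rw [hdW, ← hS, PowerSeries.mapDer_mul, hE]
      push_cast
      ring
    rw [h1, PowerSeries.X_pow_dvd_iff]
    intro i hi
    rw [map_sub, PowerSeries.coeff_mapDer, coadjointDerivation_coeff_potential hk a (by omega),
      PowerSeries.coeff_C_mul, PowerSeries.coeff_X_pow_mul', sub_eq_zero]
    congr 1
    split_ifs with hai
    · rw [map_sub, map_sub, hX, hnat, hnat]
      push_cast
      ring
    · rfl
  have hu : IsUnit S := PowerSeries.isUnit_iff_constantCoeff.2 (by rw [hS0]; exact isUnit_one)
  rw [hu.dvd_mul_left, PowerSeries.X_pow_dvd_iff] at hdvd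
  have h2 := hdvd k (Nat.lt_succ_self k)
  have hEk : PowerSeries.coeff k E = 0 := by
    rw [hE, PowerSeries.coeff_C_mul, PowerSeries.coeff_X_pow_mul']
    split_ifs with hak
    · rw [map_sub, map_sub, hdS, hX, hnat, hnat, Nat.cast_sub hak]
      ring
    · rw [mul_zero]
  rw [map_sub, map_add, map_add, hEk, add_zero, sub_zero, PowerSeries.coeff_mapDer,
    ← two_mul] at h2
  exact (mul_eq_zero.1 h2).resolve_left two_ne_zero

theorem pderiv_coeff_potential (j : WittIdx (m + 1) (2 * k + 1)) (hj : (j : ℕ) + m < 2 * k)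
    (i : ℕ) :
    pderiv j (PowerSeries.coeff i (potential f m k)) =
      if i = 2 * k - j then var f (m + 1) (2 * k + 1) (2 * k) ^ (2 * k - j - 1) else 0 := by
  have hj1 := (Finset.mem_Ico.1 j.2).1
  rw [coeff_potential]
  by_cases hi : i = 0
  · rw [if_pos hi, if_neg (by omega), Derivation.map_one_eq_zero]
  · rw [if_neg hi, pderiv_mul, pderiv_pow, pderiv_var, pderiv_var, if_neg (by omega : ¬ (j : ℕ) = 2 * k),
      mul_zero, mul_zero, add_zero]
    by_cases h2 : i = 2 * k - j
    · rw [if_pos h2, if_pos (by omega), one_mul, h2]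
    · rw [if_neg h2, if_neg (by omega), zero_mul]

/-- Only one coefficient of `W` involves `l_j`, so `2 S ∂_j S = ∂_j W` is a monomial in `t`;
multiply by `V = S⁻¹`. -/
theorem two_mul_pderiv_coeff
    {S V : PowerSeries (MvPolynomial (WittIdx (m + 1) (2 * k + 1)) f)}
    (hS : S * S = potential f m k) (hV : S * V = 1)
    (j : WittIdx (m + 1) (2 * k + 1)) (hj : (j : ℕ) + m < 2 * k)
    (hjk : k ≤ (j : ℕ)) :
    2 * pderiv j (PowerSeries.coeff k S) =
      var f (m + 1) (2 * k + 1) (2 * k) ^ (2 * k - j - 1) * PowerSeries.coeff (j - k) V := by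
  have h1 : PowerSeries.mapDer (pderiv j) (potential f m k) =
      PowerSeries.C (var f (m + 1) (2 * k + 1) (2 * k) ^ (2 * k - j - 1)) *
        PowerSeries.X ^ (2 * k - j) := by
    ext1 i
    rw [PowerSeries.coeff_mapDer, pderiv_coeff_potential j hj, PowerSeries.coeff_C_mul,
      PowerSeries.coeff_X_pow]
    split_ifs <;> simp
  have h2 : 2 * PowerSeries.mapDer (pderiv j) S =
      PowerSeries.C (var f (m + 1) (2 * k + 1) (2 * k) ^ (2 * k - j - 1)) *
        (PowerSeries.X ^ (2 * k - j) * V) := by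
    rw [← mul_assoc, ← h1, ← hS, PowerSeries.mapDer_mul]
    linear_combination (-2 * PowerSeries.mapDer (pderiv j) S) * hV
  have h3 := congrArg (PowerSeries.coeff k) h2
  rw [two_mul (PowerSeries.mapDer _ _), map_add, PowerSeries.coeff_mapDer, PowerSeries.coeff_C_mul,
    PowerSeries.coeff_X_pow_mul', if_pos (by omega), ← two_mul (pderiv j _),
    show k - (2 * k - j) = (j : ℕ) - k by have := (Finset.mem_Ico.1 j.2).2; omega] at h3
  exact h3

variable (f m k) in
/-- The retraction of `f[l_{m+1}, …, l_{2k}]` onto the subring generated by the central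
variables. -/
def centralPart : MvPolynomial (WittIdx (m + 1) (2 * k + 1)) f →ₐ[f]
    MvPolynomial (WittIdx (m + 1) (2 * k + 1)) f :=
  aeval fun i => if 2 * k ≤ (i : ℕ) + m then X i else 0

theorem centralPart_mem (F : MvPolynomial (WittIdx (m + 1) (2 * k + 1)) f) :
    centralPart f m k F ∈
      supported f {i : WittIdx (m + 1) (2 * k + 1) | 2 * k ≤ (i : ℕ) + m} := by
  rw [centralPart, aeval_def, eval₂_eq']
  refine Subalgebra.sum_mem _ fun d _ => Subalgebra.mul_mem _ (Subalgebra.algebraMap_mem _ _)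
    (Subalgebra.prod_mem _ fun i _ => Subalgebra.pow_mem _ ?_ _)
  split_ifs with h
  · exact X_mem_supported.2 h
  · exact Subalgebra.zero_mem _

theorem centralPart_var (j : ℕ) :
    centralPart f m k (var f (m + 1) (2 * k + 1) j) =
      if 2 * k ≤ j + m then var f (m + 1) (2 * k + 1) j else 0 := by
  rw [var]
  split_ifs with h1 h2 <;> simp_all [centralPart]

/-- With `ε` the central retraction, `S - εS = (W - εW) / (S + εS)`. The denominator is a unit,
having constant term `2`, and the non-central terms of `W` carry `u^{i-1}` with `i > m`, so `u^m`
divides the numerator. -/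
theorem exists_mul_eq_sub_centralPart [CharZero f]
    {S : PowerSeries (MvPolynomial (WittIdx (m + 1) (2 * k + 1)) f)}
    (hS0 : PowerSeries.constantCoeff S = 1) (hS : S * S = potential f m k) :
    ∃ P, var f (m + 1) (2 * k + 1) (2 * k) ^ m * P =
      PowerSeries.coeff k S - centralPart f m k (PowerSeries.coeff k S) := by
  set ε := (centralPart f m k).toRingHom
  set Y : PowerSeries (MvPolynomial (WittIdx (m + 1) (2 * k + 1)) f) :=
    PowerSeries.mk fun i => if i ≤ m then 0 else
      var f (m + 1) (2 * k + 1) (2 * k - i) * var f (m + 1) (2 * k + 1) (2 * k) ^ (i - 1 - m)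
  have hY : potential f m k - PowerSeries.map ε (potential f m k) =
      PowerSeries.C (var f (m + 1) (2 * k + 1) (2 * k) ^ m) * Y := by
    ext1 i
    rw [map_sub, PowerSeries.coeff_map, PowerSeries.coeff_C_mul, PowerSeries.coeff_mk,
      coeff_potential]
    have hε : ∀ F, ε F = centralPart f m k F := fun F => rfl
    by_cases hi : i = 0
    · rw [if_pos hi, if_pos (by omega), map_one, sub_self, mul_zero]
    · rw [if_neg hi, map_mul, map_pow, hε, hε, centralPart_var,
        centralPart_var, if_pos (by omega : 2 * k ≤ 2 * k + m)]
      by_cases him : i ≤ m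
      · rw [if_pos him, if_pos (by omega), sub_self, mul_zero]
      · rw [if_neg him]
        by_cases hik : 2 * k ≤ 2 * k - i + m
        -- With `i > m` this case arises only when `2 * k - i` truncates to `0`, which is not an
        -- index.
        · have : var f (m + 1) (2 * k + 1) (2 * k - i) = 0 := by
            rw [var, dif_neg]
            intro h
            have := (Finset.mem_Ico.1 h).1
            omega
          rw [this]
          simp
        · rw [if_neg hik, zero_mul, sub_zero, show i - 1 = m + (i - 1 - m) by omega, pow_add,
            show m + (i - 1 - m) - m = i - 1 - m by omega]
          ring
  have hu : IsUnit (S + PowerSeries.map ε S) := by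
    rw [PowerSeries.isUnit_iff_constantCoeff, map_add, hS0,
      ← PowerSeries.coeff_zero_eq_constantCoeff_apply, PowerSeries.coeff_map,
      PowerSeries.coeff_zero_eq_constantCoeff_apply, hS0, map_one]
    have : (1 + 1 : MvPolynomial (WittIdx (m + 1) (2 * k + 1)) f) = C 2 := by
      rw [one_add_one_eq_two]; exact (map_ofNat C 2).symm
    rw [this]
    exact (IsUnit.mk0 (2 : f) two_ne_zero).map C
  obtain ⟨U, hU⟩ := hu.exists_right_inv
  refine ⟨PowerSeries.coeff k (Y * U), ?_⟩
  rw [← PowerSeries.coeff_C_mul, ← mul_assoc, ← hY, ← hS, map_mul (PowerSeries.map ε),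
    show (S * S - PowerSeries.map ε S * PowerSeries.map ε S) * U = S - PowerSeries.map ε S by
      linear_combination (S - PowerSeries.map ε S) * hU, map_sub, PowerSeries.coeff_map]
  rfl

/-- Both derivative conditions come from `2 ∂_j P = u^{2k-j-1-m} V_{j-k}` with `V = S⁻¹`: at `j = k`
the factor `V_0` is `1`, and at the largest non-central index `j = 2k - m - 1` the power of `u`
disappears. -/
theorem exists_mem_coadjointInvariants [CharZero f] (hk : m + 1 ≤ k) :
    ∃ P ∈ coadjointInvariants (basis f (m + 1) (2 * k + 1)),
      (∀ j : WittIdx (m + 1) (2 * k + 1), (j : ℕ) = k →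
        2 * pderiv j P = var f (m + 1) (2 * k + 1) (2 * k) ^ (k - 1 - m)) ∧
      ∀ j : WittIdx (m + 1) (2 * k + 1), (j : ℕ) + (m + 1) = 2 * k →
        pderiv j P ∉ Ideal.span {var f (m + 1) (2 * k + 1) (2 * k)} := by
  obtain ⟨S, hS0, hS⟩ := PowerSeries.exists_sq_eq (potential f m k) constantCoeff_potential
  have hu : IsUnit S := PowerSeries.isUnit_iff_constantCoeff.2 (by rw [hS0]; exact isUnit_one)
  obtain ⟨V, hV⟩ := hu.exists_right_inv
  obtain ⟨P, hP⟩ := exists_mul_eq_sub_centralPart hS0 hS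
  set u := var f (m + 1) (2 * k + 1) (2 * k) with hu_def
  have hu0 : u ≠ 0 := by
    rw [hu_def, var, dif_pos (Finset.mem_Ico.2 ⟨by omega, by omega⟩)]
    exact X_ne_zero _
  have hum : u ^ m ≠ 0 := pow_ne_zero _ hu0
  have hder : ∀ j : WittIdx (m + 1) (2 * k + 1), (j : ℕ) + m < 2 * k → k ≤ (j : ℕ) →
      2 * pderiv j P = u ^ (2 * k - j - 1 - m) * PowerSeries.coeff (j - k) V := by
    intro j hj hjk
    refine mul_left_cancel₀ hum ?_
    rw [← mul_assoc (u ^ m) (u ^ _), ← pow_add, show m + (2 * k - j - 1 - m) = 2 * k - j - 1 by omega,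
      ← two_mul_pderiv_coeff hS hV j hj hjk]
    have h1 := congrArg (pderiv j) hP
    rw [map_sub, (mem_supported_iff_pderiv_eq_zero _ _).1 (centralPart_mem _) j (by simpa using hj),
      sub_zero, pderiv_mul, pderiv_pow, pderiv_var, if_neg (by omega), mul_zero, zero_mul,
      zero_add] at h1
    rw [← h1]
    ring
  refine ⟨P, ?_, ?_, ?_⟩
  · rw [mem_coadjointInvariants_iff]
    intro a
    refine (mul_eq_zero.1 ?_).resolve_left hum
    have h1 := congrArg
      (coadjointDerivation (basis f (m + 1) (2 * k + 1)) (basis f (m + 1) (2 * k + 1) a)) hP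
    have h2 : coadjointDerivation (basis f (m + 1) (2 * k + 1)) (basis f (m + 1) (2 * k + 1) a)
        u = 0 := by
      rw [hu_def, coadjointDerivation_var _ (by omega), var_of_le, smul_zero]
      have := (Finset.mem_Ico.1 a.2).1
      omega
    rw [map_sub, coadjointDerivation_coeff_eq_zero_of_sq_eq hk hS0 hS,
      supported_le_coadjointInvariants (centralPart_mem _) _, sub_zero, Derivation.leibniz,
      Derivation.leibniz_pow, h2, smul_zero, smul_zero, smul_zero, add_zero, smul_eq_mul] at h1
    exact h1
  · intro j hj
    have hV0 : PowerSeries.coeff 0 V = 1 := by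
      have := congrArg PowerSeries.constantCoeff hV
      rwa [map_mul, hS0, one_mul, map_one,
        ← PowerSeries.coeff_zero_eq_constantCoeff_apply] at this
    rw [hder j (by omega) (by omega), show (j : ℕ) - k = 0 by omega, hV0, mul_one,
      show 2 * k - j - 1 - m = k - 1 - m by omega]
  · intro j hj hmem
    have h1 := hder j (by omega) (by omega)
    rw [show 2 * k - j - 1 - m = 0 by omega, pow_zero, one_mul] at h1
    obtain ⟨G, hG⟩ := Ideal.mem_span_singleton'.1 hmem
    -- The specialization `l_{2k-1} = 1`, all other variables `0`, kills `u` and sends `W` to `1 +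
    -- t`. It thus sends `V` to an inverse square root of `1 + t`, none of whose coefficients is
    -- zero.
    set φ : MvPolynomial (WittIdx (m + 1) (2 * k + 1)) f →ₐ[f] f :=
      aeval fun i => if (i : ℕ) + 1 = 2 * k then 1 else 0
    have hφ : ∀ i, φ (var f (m + 1) (2 * k + 1) i) = if i + 1 = 2 * k then 1 else 0 := by
      intro i
      rw [var]
      by_cases h : i ∈ Finset.Ico (m + 1) (2 * k + 1)
      · rw [dif_pos h]; exact aeval_X _ _
      · rw [dif_neg h, map_zero, if_neg]
        intro h2
        exact h (Finset.mem_Ico.2 ⟨by omega, by omega⟩)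
    have hW : PowerSeries.map φ.toRingHom (potential f m k) = 1 + PowerSeries.X := by
      ext1 i
      rw [PowerSeries.coeff_map, coeff_potential, map_add, PowerSeries.coeff_one,
        PowerSeries.coeff_X]
      have hφ' : ∀ F, φ.toRingHom F = φ F := fun F => rfl
      by_cases hi : i = 0
      · subst hi; simp
      · rw [if_neg hi, map_mul, map_pow, hφ', hφ', hφ, hφ, if_neg (by omega : ¬ 2 * k + 1 = 2 * k)]
        by_cases hi1 : i = 1
        · subst hi1
          rw [if_pos (by omega)]; simp
        · rw [zero_pow (by omega), mul_zero]; simp [hi, hi1]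
    refine PowerSeries.coeff_ne_zero_of_sq_mul_eq_one (PowerSeries.map φ.toRingHom V) ?_ (j - k) ?_
    · rw [← hW, ← hS, ← map_mul, ← map_mul,
        show V * V * (S * S) = 1 by linear_combination (S * V + 1) * hV, map_one]
    · rw [PowerSeries.coeff_map, ← h1, ← hG]
      show φ _ = 0
      rw [map_mul, map_mul, hu_def, hφ, if_neg (by omega), mul_zero, mul_zero]

end WittQuot

/-! ### Generation of the invariants by the central variables and `P` -/

namespace WittQuot

open MvPolynomial

variable {f : Type*} [Field f] [CharZero f] {m k : ℕ}

/-- Induction on the degree in `l_k`: `∂_k F` is an invariant of lower degree, so a power of `u`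
times it is a polynomial in `P`. Integrate that polynomial; what is left of `F` has no `∂_k`, hence
is central. -/
theorem exists_pow_mul_eq_aeval (hk : m + 1 ≤ k)
    {P : MvPolynomial (WittIdx (m + 1) (2 * k + 1)) f}
    (hP : P ∈ coadjointInvariants (basis f (m + 1) (2 * k + 1)))
    (j : WittIdx (m + 1) (2 * k + 1)) (hj : (j : ℕ) = k) {s : ℕ}
    (hPj : 2 * pderiv j P = var f (m + 1) (2 * k + 1) (2 * k) ^ s)
    {F : MvPolynomial (WittIdx (m + 1) (2 * k + 1)) f}
    (hF : F ∈ coadjointInvariants (basis f (m + 1) (2 * k + 1))) :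
    ∃ (N : ℕ) (p : Polynomial (supported f
      {i : WittIdx (m + 1) (2 * k + 1) | 2 * k ≤ (i : ℕ) + m})),
      var f (m + 1) (2 * k + 1) (2 * k) ^ N * F = Polynomial.aeval P p := by
  set u := var f (m + 1) (2 * k + 1) (2 * k) with hu
  set S := {i : WittIdx (m + 1) (2 * k + 1) | 2 * k ≤ (i : ℕ) + m} with hS
  have huS : u ∈ supported f S := by
    rw [hu, var, dif_pos (Finset.mem_Ico.2 ⟨by omega, by omega⟩)]
    refine X_mem_supported.2 ?_
    rw [hS, Set.mem_ofPred_eq]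
    dsimp only
    omega
  have hder : ∀ q : Polynomial (supported f S), pderiv j (Polynomial.aeval P q) =
      Polynomial.aeval P (Polynomial.derivative q) * pderiv j P :=
    Derivation.map_aeval_subalgebra _ _ fun c hc =>
      (mem_supported_iff_pderiv_eq_zero _ _).1 hc j (by rw [hS, Set.mem_ofPred_eq]; omega)
  have hInv : ∀ q : Polynomial (supported f S),
      Polynomial.aeval P q ∈ coadjointInvariants (basis f (m + 1) (2 * k + 1)) := by
    intro q
    rw [Polynomial.aeval_eq_sum_range]
    refine Subalgebra.sum_mem _ fun i _ => ?_
    rw [Algebra.smul_def]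
    exact Subalgebra.mul_mem _ (supported_le_coadjointInvariants (q.coeff i).2)
      (Subalgebra.pow_mem _ hP _)
  have key : ∀ (d : ℕ) (F : MvPolynomial (WittIdx (m + 1) (2 * k + 1)) f),
      F ∈ coadjointInvariants (basis f (m + 1) (2 * k + 1)) →
      (∀ e : WittIdx (m + 1) (2 * k + 1) →₀ ℕ, d ≤ e j → coeff e F = 0) →
      ∃ (N : ℕ) (p : Polynomial (supported f S)), u ^ N * F = Polynomial.aeval P p := by
    intro d
    induction d with
    | zero =>
      intro F _ hF0
      refine ⟨0, 0, ?_⟩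
      rw [show F = 0 from MvPolynomial.ext _ _ fun e => hF0 e (Nat.zero_le _)]
      simp
    | succ d ih =>
      intro F hF hFd
      obtain ⟨N, p, hp⟩ := ih (pderiv j F)
        (pderiv_mem_coadjointInvariants hF j (by omega) (by omega)) fun e he => by
          rw [coeff_pderiv, hFd _ (by simpa using he), zero_mul]
      obtain ⟨q, hq⟩ := Polynomial.exists_derivative_eq (f := f) p
      -- The doubled antiderivative and the extra `u^s` match `2 ∂_k P = u^s`.
      have hK : u ^ (N + s) * F - Polynomial.aeval P (q + q) ∈
          coadjointInvariants (basis f (m + 1) (2 * k + 1)) :=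
        Subalgebra.sub_mem _ (Subalgebra.mul_mem _ (supported_le_coadjointInvariants
          (Subalgebra.pow_mem _ huS _)) hF) (hInv _)
      have hKj : pderiv j (u ^ (N + s) * F - Polynomial.aeval P (q + q)) = 0 := by
        rw [map_sub, hder, map_add, hq, map_add, ← hp, pderiv_mul, pderiv_pow, hu, pderiv_var,
          if_neg (by omega), ← hu]
        linear_combination (-u ^ N * pderiv j F) * hPj
      have hKS : u ^ (N + s) * F - Polynomial.aeval P (q + q) ∈ supported f S := by
        rw [mem_supported_iff_pderiv_eq_zero]
        intro i hi
        refine eq_zero_of_sum_var_mul_eq_zero (n := 2 * k) (v := fun i => pderiv i _) (fun a => ?_)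
          i (by simpa [hS] using hi) fun c _ hc => ?_
        · rw [← coadjointDerivation_eq_sum]
          exact hK _
        · rw [show c = j from Subtype.ext (by omega)]
          exact hKj
      refine ⟨N + s, Polynomial.C ⟨_, hKS⟩ + (q + q), ?_⟩
      rw [map_add, Polynomial.aeval_C]
      show _ = (u ^ (N + s) * F - Polynomial.aeval P (q + q)) + _
      ring
  exact key (degreeOf j F + 1) F hF fun e he => by
    by_contra h
    have := monomial_le_degreeOf j (mem_support_iff.2 h)
    omega

/-- If `u` divides `p(P)`, then `u` divides every coefficient of `p`: `∂_j` kills the central ring,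
preserves the prime ideal `(u)` and does not send `P` into it. One factor `u` is cancelled at a
time. -/
theorem exists_eq_aeval_of_pow_mul_eq (hk : m + 1 ≤ k)
    {P : MvPolynomial (WittIdx (m + 1) (2 * k + 1)) f}
    (j : WittIdx (m + 1) (2 * k + 1)) (hj : (j : ℕ) + (m + 1) = 2 * k)
    (hPj : pderiv j P ∉ Ideal.span {var f (m + 1) (2 * k + 1) (2 * k)})
    (N : ℕ) (F : MvPolynomial (WittIdx (m + 1) (2 * k + 1)) f)
    (p : Polynomial (supported f {i : WittIdx (m + 1) (2 * k + 1) | 2 * k ≤ (i : ℕ) + m}))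
    (hp : var f (m + 1) (2 * k + 1) (2 * k) ^ N * F = Polynomial.aeval P p) :
    ∃ q : Polynomial (supported f {i : WittIdx (m + 1) (2 * k + 1) | 2 * k ≤ (i : ℕ) + m}),
      F = Polynomial.aeval P q := by
  revert p
  set u := var f (m + 1) (2 * k + 1) (2 * k) with hu
  set S := {i : WittIdx (m + 1) (2 * k + 1) | 2 * k ≤ (i : ℕ) + m} with hS
  have huX : u = X ⟨2 * k, Finset.mem_Ico.2 ⟨by omega, by omega⟩⟩ := by
    rw [hu, var, dif_pos]
  have hu0 : u ≠ 0 := huX ▸ X_ne_zero _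
  have huS : u ∈ supported f S := by
    rw [huX]
    refine X_mem_supported.2 ?_
    rw [hS, Set.mem_ofPred_eq]
    dsimp only
    omega
  have huS' : ∀ i ∉ S, pderiv i u = 0 := (mem_supported_iff_pderiv_eq_zero _ _).1 huS
  have hjS : j ∉ S := by rw [hS, Set.mem_ofPred_eq]; omega
  have : (Ideal.span {u}).IsPrime :=
    (Ideal.span_singleton_prime hu0).2 (huX ▸ X_prime)
  induction N with
  | zero =>
    intro p hp
    exact ⟨p, by rw [← hp, pow_zero, one_mul]⟩
  | succ N ih =>
    intro p hp
    have h1 : ∀ i, ((p.coeff i : supported f S) : MvPolynomial _ f) ∈ Ideal.span {u} := by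
      refine Derivation.coeff_mem_of_aeval_mem _ (pderiv j)
        (fun c hc => (mem_supported_iff_pderiv_eq_zero _ _).1 hc j hjS) _ (fun x hx => ?_) hPj p ?_
      · obtain ⟨y, rfl⟩ := Ideal.mem_span_singleton'.1 hx
        rw [pderiv_mul, huS' j hjS, mul_zero, add_zero]
        exact Ideal.mem_span_singleton'.2 ⟨_, rfl⟩
      · rw [← hp, pow_succ, mul_right_comm]
        exact Ideal.mem_span_singleton'.2 ⟨_, rfl⟩
    have h2 : Polynomial.C (⟨u, huS⟩ : supported f S) ∣ p := by
      rw [Polynomial.C_dvd_iff_dvd_coeff]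
      intro i
      obtain ⟨g, hg⟩ := Ideal.mem_span_singleton'.1 (h1 i)
      -- The quotient of a central coefficient by `u` is again central, so the division takes place
      -- inside the coefficient ring.
      have hgS : g ∈ supported f S := by
        rw [mem_supported_iff_pderiv_eq_zero]
        intro c hc
        have h3 := (mem_supported_iff_pderiv_eq_zero _ _).1 (p.coeff i).2 c hc
        rw [← hg, pderiv_mul, huS' c hc, mul_zero, add_zero] at h3
        exact (mul_eq_zero.1 h3).resolve_right hu0
      exact ⟨⟨g, hgS⟩, Subtype.ext (by rw [← hg]; exact mul_comm _ _)⟩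
    obtain ⟨q, rfl⟩ := h2
    refine ih q (mul_left_cancel₀ hu0 ?_)
    rw [map_mul, Polynomial.aeval_C] at hp
    rw [← mul_assoc, ← pow_succ', hp]
    rfl

theorem exists_coadjointInvariants_eq_adjoin (hk : m + 1 ≤ k) :
    ∃ P : MvPolynomial (WittIdx (m + 1) (2 * k + 1)) f,
      coadjointInvariants (basis f (m + 1) (2 * k + 1)) =
        Algebra.adjoin f (X ''
          {i : WittIdx (m + 1) (2 * k + 1) | 2 * k ≤ (i : ℕ) + m} ∪ {P}) ∧
      AlgebraicIndependent f
        (fun o : Option {i : WittIdx (m + 1) (2 * k + 1) // 2 * k ≤ (i : ℕ) + m} =>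
          o.elim P (fun i => X i.1)) := by
  obtain ⟨P, hP, hPk, hPm⟩ := exists_mem_coadjointInvariants (f := f) hk
  set j : WittIdx (m + 1) (2 * k + 1) := ⟨k, Finset.mem_Ico.2 ⟨by omega, by omega⟩⟩ with hj
  refine ⟨P, le_antisymm (fun F hF => ?_) ?_, ?_⟩
  · obtain ⟨N, p, hp⟩ := exists_pow_mul_eq_aeval hk hP j rfl (hPk j rfl) hF
    obtain ⟨q, rfl⟩ := exists_eq_aeval_of_pow_mul_eq hk
      ⟨2 * k - (m + 1), Finset.mem_Ico.2 ⟨by omega, by omega⟩⟩ (by dsimp only; omega)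
      (hPm _ (by dsimp only; omega)) N F p hp
    rw [Algebra.adjoin_union_eq_adjoin_adjoin, Subalgebra.mem_restrictScalars,
      Algebra.adjoin_singleton_eq_range_aeval]
    exact ⟨q, rfl⟩
  · rw [Algebra.adjoin_le_iff, Set.union_subset_iff, Set.singleton_subset_iff]
    exact ⟨Algebra.adjoin_le_iff.1 supported_le_coadjointInvariants, hP⟩
  · rw [AlgebraicIndependent.option_iff]
    refine ⟨(algebraicIndependent_X _ f).comp _ Subtype.val_injective, ?_⟩
    have hr : Set.range (fun i : {i : WittIdx (m + 1) (2 * k + 1) // 2 * k ≤ (i : ℕ) + m} =>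
        (X i.1 : MvPolynomial (WittIdx (m + 1) (2 * k + 1)) f)) =
        X '' {i : WittIdx (m + 1) (2 * k + 1) | 2 * k ≤ (i : ℕ) + m} := by
      rw [Set.image_eq_range]
      rfl
    rw [hr, transcendental_iff]
    intro p hp
    -- Independence is the same transcendence argument with the zero ideal and `∂_k`, since `2 ∂_k
    -- P` is a power of `u`.
    have hPj : pderiv j P ∉ (⊥ : Ideal (MvPolynomial (WittIdx (m + 1) (2 * k + 1)) f)) := by
      rw [Ideal.mem_bot]
      intro h
      have h1 := hPk j rfl
      rw [h, mul_zero, var, dif_pos (Finset.mem_Ico.2 ⟨by omega, by omega⟩)] at h1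
      exact pow_ne_zero _ (X_ne_zero _) h1.symm
    refine Polynomial.ext fun i => Subtype.ext ?_
    refine Ideal.mem_bot.1 (Derivation.coeff_mem_of_aeval_mem
      (supported f {i : WittIdx (m + 1) (2 * k + 1) | 2 * k ≤ (i : ℕ) + m}) (pderiv j)
      (fun c hc => (mem_supported_iff_pderiv_eq_zero _ _).1 hc j ?_) ⊥ ?_ hPj p
      (Ideal.mem_bot.2 hp) i)
    · rw [Set.mem_ofPred_eq, hj]
      dsimp only
      omega
    · intro x hx
      rw [Ideal.mem_bot.1 hx, map_zero]
      exact Ideal.zero_mem _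

end WittQuot
end

theorem mainTheorem9 {f : Type*} [Field f] [CharZero f] (m n : ℕ) :
    (Odd n →
      coadjointInvariants (WittQuot.basis f (m + 1) (n + 1)) =
        Algebra.adjoin f (MvPolynomial.X ''
          {i : WittIdx (m + 1) (n + 1) | n ≤ (i : ℕ) + m}) ∧
      coadjointOrbitInvariants (WittQuot.basis f (m + 1) (n + 1)) =
        Algebra.adjoin f (MvPolynomial.X ''
          {i : WittIdx (m + 1) (n + 1) | n ≤ (i : ℕ) + m})) ∧
    (Even n → ∃ P : MvPolynomial (WittIdx (m + 1) (n + 1)) f,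
      coadjointInvariants (WittQuot.basis f (m + 1) (n + 1)) =
        Algebra.adjoin f (MvPolynomial.X ''
          {i : WittIdx (m + 1) (n + 1) | n ≤ (i : ℕ) + m} ∪ {P}) ∧
      coadjointOrbitInvariants (WittQuot.basis f (m + 1) (n + 1)) =
        Algebra.adjoin f (MvPolynomial.X ''
          {i : WittIdx (m + 1) (n + 1) | n ≤ (i : ℕ) + m} ∪ {P}) ∧
      (2 * m + 2 ≤ n → AlgebraicIndependent f
        (fun o : Option {i : WittIdx (m + 1) (n + 1) // n ≤ (i : ℕ) + m} =>
          o.elim P (fun i => MvPolynomial.X i.1)))) := by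
  rw [coadjointOrbitInvariants_eq_coadjointInvariants _ WittQuot.isNilpotent_toEnd_dual]
  refine ⟨fun hn => ⟨WittQuot.coadjointInvariants_of_odd hn,
    WittQuot.coadjointInvariants_of_odd hn⟩, fun hn => ?_⟩
  obtain ⟨k, rfl⟩ := even_iff_exists_two_mul.1 hn
  by_cases hk : m + 1 ≤ k
  · obtain ⟨P, h1, h2⟩ := WittQuot.exists_coadjointInvariants_eq_adjoin (f := f) hk
    exact ⟨P, h1, h1, fun _ => h2⟩
  -- For `k ≤ m` every variable is central, so the whole polynomial ring is invariant and `P = 0`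
  -- serves.
  · have h : coadjointInvariants (WittQuot.basis f (m + 1) (2 * k + 1)) =
        Algebra.adjoin f (MvPolynomial.X ''
          {i : WittIdx (m + 1) (2 * k + 1) | 2 * k ≤ (i : ℕ) + m} ∪ {0}) := by
      refine le_antisymm ?_ (Algebra.adjoin_le_iff.2 (Set.union_subset
        (Algebra.adjoin_le_iff.1 WittQuot.supported_le_coadjointInvariants)
        (Set.singleton_subset_iff.2 (Subalgebra.zero_mem _))))
      intro F _
      refine Algebra.adjoin_mono Set.subset_union_left ?_
      have hu : {i : WittIdx (m + 1) (2 * k + 1) | 2 * k ≤ (i : ℕ) + m} = Set.univ := by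
        refine Set.eq_univ_of_forall fun i => ?_
        have hi := (Finset.mem_Ico.1 i.2).1
        rw [Set.mem_ofPred_eq]
        omega
      rw [hu, Set.image_univ, MvPolynomial.adjoin_range_X]
      exact Algebra.mem_top
    exact ⟨0, h, h, fun h2 => absurd h2 (by omega)⟩
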